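/- Let $(\mathcal P,\preceq)$ be a finite partially ordered set and $\mathbf n=(n_i)_{i\in\mathcal P}$ a family of positive integers. An integer square matrix $B$ with rows and columns partitioned into blocks of sizes $n_i$, $i\in\mathcal P$, belongs to $\mathfrak M_{\mathcal P}(\mathbf n,\mathbb Z)$ if its block $B\{i,j\}$ is zero unless $i\preceq j$; it belongs to $\mathrm{GL}_{\mathcal P}(\mathbf n,\mathbb Z)$ if moreover each diagonal block is invertible over $\mathbb Z$. For $c,d\subseteq\mathcal P$ let $B\{c,d\}$ be the submatrix of $B$ with row blocks in $c$ and column blocks in $d$, and write $B\{c\}=B\{c,c\}$ and $B\{i\}=B\{\{i\}\}$. Matrices act on column vectors: $\ker B\{c\}$ and $\operatorname{cok}B\{c\}$ are the kernel and the cokernel of $x\mapsto B\{c\}x$. Let $r_i=\{j: j\prec i\}$ and $s_i=\{j: j\preceq i\}$. The $K$-web $K(B)$ of $B\in\mathfrak M_{\mathcal P}(\mathbf n,\mathbb Z)$ consists of the sequences $$\ker B\{i\}\to\operatorname{cok}B\{r_i\}\to\operatorname{cok}B\{s_i\}\to\operatorname{cok}B\{i\}$$ for all nonminimal $i\in\mathcal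 P$, the maps $\operatorname{cok}B\{s_j\}\to\operatorname{cok}B\{r_i\}$ for all $i$ and all immediate predecessors $j$ of $i$, and the groups $\operatorname{cok}B\{i\}$ for minimal $i$. Here the first map is $x\mapsto[B\{r_i,\{i\}\}x]$, and the others are induced by extension of vectors by zero, respectively (for $\operatorname{cok}B\{s_i\}\to\operatorname{cok}B\{i\}$) by restriction of vectors. A $K$-web isomorphism $\kappa\colon K(B)\to K(B')$ is a family of isomorphisms, one between each pair of corresponding groups (indexed by subsets of $\mathcal P$), that commutes with all these maps; $d_i\colon\operatorname{cok}B\{i\}\to\operatorname{cok}B'\{i\}$ denotes the isomorphism at $i$ that belongs to $\kappa$. A $\mathrm{GL}_{\mathcal P}$-equivalence $(U,V)\colon B\to B'$ is a pair $U,V\in\mathrm{GL}_{\mathcal P}(\mathbf n,\mathbb Z)$ with $UBV=B'$. It induces the $K$-web isomorphism $\kappa_{(U,V)}$ given by $[x]\mapsto[U\{c\}x]$ on $\operatorname{cok}B\{c\}$ and by $x\mapsto V^{-1}\{i\}x$ on $\ker B\{i\}$. For square integer matrices $M,M'$ of the same size, an isomorphism $f\colon\operatorname{cok}M\to\operatorname{cok}M'$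 is $\mathrm{GL}$-allowable if there are invertible integer matrices $U,V$ with $UMV=M'$ and $f([x])=[Ux]$ for all $x$. **Theorem.** Let $B,B'\in\mathfrak M_{\mathcal P}(\mathbf n,\mathbb Z)$ satisfy $B\{i\}=B'\{i\}$ for all $i\in\mathcal P$, let $\kappa\colon K(B)\to K(B')$ be a $K$-web isomorphism, and for each minimal $i\in\mathcal P$ let $\psi_i\colon\ker B\{i\}\to\ker B'\{i\}$ be an automorphism. Then there is a $\mathrm{GL}_{\mathcal P}$-equivalence $(U,V)\colon B\to B'$ with $\kappa_{(U,V)}=\kappa$ if and only if each automorphism $d_i\colon\operatorname{cok}B\{i\}\to\operatorname{cok}B'\{i\}$, $i\in\mathcal P$, is $\mathrm{GL}$-allowable. Moreover, whenever such a $\mathrm{GL}_{\mathcal P}$-equivalence exists, it can be chosen such that in addition $V^{-1}\{i\}$ induces $\psi_i$ (i.e. $\psi_i(x)=V^{-1}\{i\}x$ for $x\in\ker B\{i\}$) for each minimal $i\in\mathcal P$. -/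

import Mathlib

noncomputable section

namespace KWeb

variable {P : Type*}

/-- The positions of an `n × n` block matrix: block `i` has `n i` rows and columns. -/
abbrev Pos (n : P → ℕ) : Type _ := Σ i : P, Fin (n i)

/-- The positions that belong to the blocks indexed by `c`. -/
def Idx (n : P → ℕ) (c : Set P) : Type _ := {x : Pos n // x.1 ∈ c}

instance instFintypeIdx [Fintype P] (n : P → ℕ) (c : Set P) : Fintype (Idx n c) :=
  haveI : Finite (Idx n c) := inferInstanceAs (Finite {x : Pos n // x.1 ∈ c})
  Fintype.ofFinite _

instance instDecidableEqIdx [DecidableEq P] (n : P → ℕ) (c : Set P) : DecidableEq (Idx n c) :=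
  inferInstanceAs (DecidableEq {x : Pos n // x.1 ∈ c})

/-- The inclusion of the positions over `c` into those over a larger set `d`. -/
def Idx.incl (n : P → ℕ) {c d : Set P} (h : c ⊆ d) (x : Idx n c) : Idx n d := ⟨x.1, h x.2⟩

lemma Idx.incl_injective (n : P → ℕ) {c d : Set P} (h : c ⊆ d) :
    Function.Injective (Idx.incl n h) := fun _ _ hxy =>
  Subtype.ext (congrArg (fun z : Idx n d => z.1) hxy)

/-- The submatrix `B{c,d}` with the row blocks in `c` and the column blocks in `d`. -/
def block {n : P → ℕ} (B : Matrix (Pos n) (Pos n) ℤ) (c d : Set P) :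
    Matrix (Idx n c) (Idx n d) ℤ :=
  B.submatrix (fun x => x.1) (fun x => x.1)

/-- The principal submatrix `B{c} = B{c,c}`. -/
abbrev sub {n : P → ℕ} (B : Matrix (Pos n) (Pos n) ℤ) (c : Set P) :
    Matrix (Idx n c) (Idx n c) ℤ :=
  block B c c

/-- The kernel of an integer matrix acting on column vectors. -/
abbrev Ker {ι κ : Type*} [Fintype κ] (M : Matrix ι κ ℤ) : Submodule ℤ (κ → ℤ) :=
  LinearMap.ker M.mulVecLin

/-- The cokernel of an integer matrix acting on column vectors. -/
abbrev Cok {ι κ : Type*} [Fintype κ] (M : Matrix ι κ ℤ) : Type _ :=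
  (ι → ℤ) ⧸ LinearMap.range M.mulVecLin

/-- The class `[x]` in the cokernel of `M` of a vector `x`. -/
abbrev Cok.mk {ι κ : Type*} [Fintype κ] (M : Matrix ι κ ℤ) (x : ι → ℤ) : Cok M :=
  Submodule.Quotient.mk x

/-- An isomorphism `f : cok M → cok M'` is `GL`-allowable if it is induced by a
`GL`-equivalence from `M` to `M'`: there are invertible integer matrices `U`, `V` with
`U M V = M'` and `f [x] = [U x]`. (For `M = M'` this is a condition on automorphisms.) -/
def GLAllowable {ι : Type*} [Fintype ι] [DecidableEq ι] {M M' : Matrix ι ι ℤ}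
    (f : Cok M ≃ₗ[ℤ] Cok M') : Prop :=
  ∃ U V : Matrix ι ι ℤ, IsUnit U.det ∧ IsUnit V.det ∧ U * M * V = M' ∧
    ∀ x : ι → ℤ, f (Cok.mk M x) = Cok.mk M' (U.mulVec x)

/-- Extension of vectors by zero. -/
def extVec (n : P → ℕ) {r s : Set P} (h : r ⊆ s) : (Idx n r → ℤ) →ₗ[ℤ] (Idx n s → ℤ) :=
  Function.ExtendByZero.linearMap ℤ (Idx.incl n h)

/-- Restriction of vectors. -/
def resVec (n : P → ℕ) {d s : Set P} (h : d ⊆ s) : (Idx n s → ℤ) →ₗ[ℤ] (Idx n d → ℤ) :=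
  LinearMap.funLeft ℤ ℤ (Idx.incl n h)

lemma extVec_incl (n : P → ℕ) {r s : Set P} (h : r ⊆ s) (x : Idx n r → ℤ) (k : Idx n r) :
    extVec n h x (Idx.incl n h k) = x k :=
  (Idx.incl_injective n h).extend_apply x (0 : Idx n s → ℤ) k

lemma extVec_of_notMem (n : P → ℕ) {r s : Set P} (h : r ⊆ s) (x : Idx n r → ℤ) (k : Idx n s)
    (hk : k.1.1 ∉ r) : extVec n h x k = 0 := by
  refine Function.extend_apply' x (0 : Idx n s → ℤ) k ?_
  rintro ⟨l, rfl⟩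
  exact hk l.2

section Order

variable [PartialOrder P] [Fintype P]

/-- `B` is a block matrix over the poset `P`: the block `B{i,j}` vanishes unless `i ≤ j`. -/
def IsMP {n : P → ℕ} (B : Matrix (Pos n) (Pos n) ℤ) : Prop :=
  ∀ x y : Pos n, B x y ≠ 0 → x.1 ≤ y.1

/-- `U` belongs to `GL_P`: it is a block matrix over `P` with invertible diagonal blocks. -/
def IsGLP [DecidableEq P] {n : P → ℕ} (U : Matrix (Pos n) (Pos n) ℤ) : Prop :=
  IsMP U ∧ ∀ i : P, IsUnit (sub U {i}).det

/-- `(U, V)` is a `GL_P`-equivalence from `B` to `B'`. -/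
def IsGLPEquiv [DecidableEq P] {n : P → ℕ} (U V B B' : Matrix (Pos n) (Pos n) ℤ) : Prop :=
  IsGLP U ∧ IsGLP V ∧ U * B * V = B'

lemma sub_mulVec_extVec {n : P → ℕ} {B : Matrix (Pos n) (Pos n) ℤ} (hB : IsMP B)
    {r s : Set P} (h : r ⊆ s) (hr : IsLowerSet r) (x : Idx n r → ℤ) :
    (sub B s).mulVec (extVec n h x) = extVec n h ((sub B r).mulVec x) := by
  have key : ∀ k : Idx n s, (sub B s).mulVec (extVec n h x) k
      = ∑ l : Idx n r, B k.1 l.1 * x l := by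
    intro k
    rw [Matrix.mulVec, dotProduct]
    symm
    refine Finset.sum_of_injOn (Idx.incl n h) (Idx.incl_injective n h).injOn (by simp) ?_ ?_
    · intro l _ hl
      rw [extVec_of_notMem, mul_zero]
      intro hlr
      exact hl ⟨⟨l.1, hlr⟩, Finset.mem_coe.2 (Finset.mem_univ _), rfl⟩
    · intro l _
      rw [extVec_incl]
      rfl
  funext k
  rw [key]
  by_cases hk : k.1.1 ∈ r
  · exact (extVec_incl n h ((sub B r).mulVec x) ⟨k.1, hk⟩).symm
  · rw [extVec_of_notMem n h _ k hk]
    refine Finset.sum_eq_zero fun l _ => ?_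
    have : B k.1 l.1 = 0 := by
      by_contra h0
      exact hk (hr (hB _ _ h0) l.2)
    rw [this, zero_mul]

lemma sub_mulVec_resVec {n : P → ℕ} {B : Matrix (Pos n) (Pos n) ℤ} (hB : IsMP B)
    {d s : Set P} (h : d ⊆ s) (hd : ∀ a ∈ d, ∀ b ∈ s, a ≤ b → b ∈ d) (x : Idx n s → ℤ) :
    (sub B d).mulVec (resVec n h x) = resVec n h ((sub B s).mulVec x) := by
  funext k
  change ∑ l : Idx n d, B k.1 l.1 * x (Idx.incl n h l) = ∑ l : Idx n s, B k.1 l.1 * x l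
  refine Finset.sum_of_injOn (Idx.incl n h) (Idx.incl_injective n h).injOn (by simp) ?_ ?_
  · intro l _ hl
    have : B k.1 l.1 = 0 := by
      by_contra h0
      exact hl ⟨⟨l.1, hd _ k.2 _ l.2 (hB _ _ h0)⟩, Finset.mem_coe.2 (Finset.mem_univ _), rfl⟩
    rw [this, zero_mul]
  · intro l _
    rfl

/-- The map `cok B{r} → cok B{s}` induced by extension by zero, for a lower set `r ⊆ s`. -/
def cokIncl {n : P → ℕ} {B : Matrix (Pos n) (Pos n) ℤ} (hB : IsMP B) {r s : Set P}
    (h : r ⊆ s) (hr : IsLowerSet r) : Cok (sub B r) →ₗ[ℤ] Cok (sub B s) :=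
  Submodule.mapQ _ _ (extVec n h) (by
    rintro _ ⟨x, rfl⟩
    exact ⟨extVec n h x, sub_mulVec_extVec hB h hr x⟩)

/-- The map `cok B{s} → cok B{d}` induced by restriction, for `d ⊆ s` upward closed in `s`. -/
def cokRes {n : P → ℕ} {B : Matrix (Pos n) (Pos n) ℤ} (hB : IsMP B) {d s : Set P}
    (h : d ⊆ s) (hd : ∀ a ∈ d, ∀ b ∈ s, a ≤ b → b ∈ d) : Cok (sub B s) →ₗ[ℤ] Cok (sub B d) :=
  Submodule.mapQ _ _ (resVec n h) (by
    rintro _ ⟨x, rfl⟩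
    exact ⟨resVec n h x, sub_mulVec_resVec hB h hd x⟩)

/-- The connecting map `ker B{d} → cok B{r}`, `x ↦ [B{r,d} x]`. -/
def conn {n : P → ℕ} (B : Matrix (Pos n) (Pos n) ℤ) (d r : Set P) :
    Ker (sub B d) →ₗ[ℤ] Cok (sub B r) :=
  (Submodule.mkQ _ ∘ₗ (block B r d).mulVecLin) ∘ₗ (Ker (sub B d)).subtype

/-- The map `cok B{j : j < i} → cok B{j : j ≤ i}`. -/
def cokStep {n : P → ℕ} {B : Matrix (Pos n) (Pos n) ℤ} (hB : IsMP B) (i : P) :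
    Cok (sub B (Set.Iio i)) →ₗ[ℤ] Cok (sub B (Set.Iic i)) :=
  cokIncl hB Set.Iio_subset_Iic_self (isLowerSet_Iio i)

/-- The map `cok B{j : j ≤ i} → cok B{i}`. -/
def cokTop {n : P → ℕ} {B : Matrix (Pos n) (Pos n) ℤ} (hB : IsMP B) (i : P) :
    Cok (sub B (Set.Iic i)) →ₗ[ℤ] Cok (sub B {i}) :=
  cokRes hB (Set.singleton_subset_iff.2 (le_refl i)) (by
    rintro a rfl b hb hab
    exact le_antisymm hb hab)

/-- The map `cok B{k : k ≤ j} → cok B{k : k < i}` for `j < i`. -/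
def cokLink {n : P → ℕ} {B : Matrix (Pos n) (Pos n) ℤ} (hB : IsMP B) {i j : P} (h : j < i) :
    Cok (sub B (Set.Iic j)) →ₗ[ℤ] Cok (sub B (Set.Iio i)) :=
  cokIncl hB (fun _ hk => lt_of_le_of_lt hk h) (isLowerSet_Iic j)

/-- The subsets `c` of `P` whose cokernel `cok B{c}` occurs in the `K`-web of `B`: the sets
`{i}` and `{j : j ≤ i}` for all `i`, and `{j : j < i}` for all nonminimal `i`. -/
inductive IsWebSet : Set P → Prop
  | point (i : P) : IsWebSet {i}
  | closed (i : P) : IsWebSet (Set.Iic i)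
  | bdry (i : P) (hi : ¬ IsMin i) : IsWebSet (Set.Iio i)

/-- A `K`-web isomorphism `K(B) → K(B')`. The `K`-web of `B` consists of the sequences
`ker B{i} → cok B{j : j < i} → cok B{j : j ≤ i} → cok B{i}` for nonminimal `i`, the maps
`cok B{k : k ≤ j} → cok B{k : k < i}` for `j` an immediate predecessor of `i`,
and the groups `cok B{i}` for minimal `i`. An isomorphism consists of one isomorphism for each
group that occurs, such that all the squares commute. Cokernels are indexed by subsets of `P`, so
that a group that occurs at several places gets a single isomorphism. -/
structure KWebIso {n : P → ℕ} {B B' : Matrix (Pos n) (Pos n) ℤ}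
    (hB : IsMP B) (hB' : IsMP B') where
  cok : ∀ c : Set P, IsWebSet c → (Cok (sub B c) ≃ₗ[ℤ] Cok (sub B' c))
  ker : ∀ i : P, ¬ IsMin i → (Ker (sub B {i}) ≃ₗ[ℤ] Ker (sub B' {i}))
  comm_conn : ∀ (i : P) (hi : ¬ IsMin i) (x : Ker (sub B {i})),
    cok (Set.Iio i) (.bdry i hi) (conn B {i} (Set.Iio i) x) = conn B' {i} (Set.Iio i) (ker i hi x)
  comm_step : ∀ (i : P) (hi : ¬ IsMin i) (x : Cok (sub B (Set.Iio i))),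
    cok (Set.Iic i) (.closed i) (cokStep hB i x) =
      cokStep hB' i (cok (Set.Iio i) (.bdry i hi) x)
  comm_top : ∀ (i : P), ¬ IsMin i → ∀ x : Cok (sub B (Set.Iic i)),
    cok {i} (.point i) (cokTop hB i x) = cokTop hB' i (cok (Set.Iic i) (.closed i) x)
  comm_link : ∀ (i j : P) (h : j ⋖ i) (hi : ¬ IsMin i) (x : Cok (sub B (Set.Iic j))),
    cok (Set.Iio i) (.bdry i hi) (cokLink hB h.lt x) =
      cokLink hB' h.lt (cok (Set.Iic j) (.closed j) x)

/-- The isomorphism `d_i : cok B{i} → cok B'{i}` that is part of a `K`-web isomorphism. -/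
def KWebIso.diag {n : P → ℕ} {B B' : Matrix (Pos n) (Pos n) ℤ} {hB : IsMP B} {hB' : IsMP B'}
    (f : KWebIso hB hB') (i : P) : Cok (sub B {i}) ≃ₗ[ℤ] Cok (sub B' {i}) :=
  f.cok {i} (.point i)

/-- `V⁻¹{i}` induces the isomorphism `g : ker B{i} → ker B'{i}`. -/
def InducesKer [DecidableEq P] {n : P → ℕ} {B B' : Matrix (Pos n) (Pos n) ℤ}
    (V : Matrix (Pos n) (Pos n) ℤ) (i : P)
    (g : Ker (sub B {i}) ≃ₗ[ℤ] Ker (sub B' {i})) : Prop :=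
  ∀ x : Ker (sub B {i}), (g x : Idx n {i} → ℤ) = (sub V⁻¹ {i}).mulVec x

/-- The `K`-web isomorphism `f` is the one that `(U, V)` induces: `[x] ↦ [U{c} x]` on the
cokernels and `x ↦ V⁻¹{i} x` on the kernels. -/
def KWebIso.InducedBy [DecidableEq P] {n : P → ℕ} {B B' : Matrix (Pos n) (Pos n) ℤ}
    {hB : IsMP B} {hB' : IsMP B'} (f : KWebIso hB hB') (U V : Matrix (Pos n) (Pos n) ℤ) : Prop :=
  (∀ (c : Set P) (hc : IsWebSet c) (x : Idx n c → ℤ),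
    f.cok c hc (Cok.mk (sub B c) x) = Cok.mk (sub B' c) ((sub U c).mulVec x)) ∧
  ∀ (i : P) (hi : ¬ IsMin i), InducesKer V i (f.ker i hi)

end Order

end KWeb

end

noncomputable section

set_option linter.unusedSectionVars false

namespace KWeb

/-! ### Linear algebra: extending a cokernel isomorphism by one block -/

section Lifting

/-! With `W = V⁻¹` the equation `U B V = B'` becomes `U B = B' W`, which is solved one block column
at a time along the order. Assume the columns `j < i` are done. The links of the web show that
`U{r_i}` already induces `κ` on `cok B{r_i}` (`KWebIso.inducedAt_bdry`). Over `s_i` both matrices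
are block triangular with last diagonal block `b`, `b'`, and allowability of `d_i` supplies the
diagonal block `A` of `U`.

`exists_block_extension` finds the rest. Lifting `κ` at `s_i` along a free module gives the column
of `U`; its diagonal part can be corrected to `A` because the web commutes with restriction to `i`.
Exactness then gives a column of `W`. Its diagonal block is prescribed on `ker b`, a direct summand,
where the connecting maps say that the prescription is consistent. For minimal `i` the prescription
is free, hence the `ψ_i`. `exists_column` translates this to matrices and `exists_columns` iterates
it. Conversely, diagonal blocks of products are products of diagonal blocks. -/

/-- Corestricting `f` to its range makes it surjective, so pointwise solvability already yields a
linear solution. -/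
lemma exists_linearMap_lift {R M N Q : Type*} [CommRing R] [AddCommGroup M] [Module R M]
    [AddCommGroup N] [Module R N] [AddCommGroup Q] [Module R Q] [Module.Projective R M]
    (f : N →ₗ[R] Q) (g : M →ₗ[R] Q) (h : ∀ x, ∃ y, f y = g x) :
    ∃ l : M →ₗ[R] N, ∀ x, f (l x) = g x := by
  obtain ⟨l, hl⟩ := Module.projective_lifting_property f.rangeRestrict
    (g.codRestrict (LinearMap.range f) h) f.surjective_rangeRestrict
  refine ⟨l, fun x => ?_⟩
  exact congrArg Subtype.val (LinearMap.congr_fun hl x)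

/-- A linear map out of a free module over a PID factors through a projection along its kernel. -/
lemma exists_ker_projection {R M N : Type*} [CommRing R] [IsDomain R] [IsPrincipalIdealRing R]
    [AddCommGroup M] [Module R M] [AddCommGroup N] [Module R N] [Module.Free R N]
    [Module.Finite R N] (b : M →ₗ[R] N) :
    ∃ (q : M →ₗ[R] M) (p : M →ₗ[R] LinearMap.ker b),
      (∀ t, b (q t) = b t) ∧ (∀ k ∈ LinearMap.ker b, q k = 0) ∧ ∀ t, (p t : M) + q t = t := by
  -- The range of `b` is free, as a submodule of a free module over a PID, so `b` has a section `s`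
  -- over it.
  obtain ⟨s, hs⟩ := exists_linearMap_lift b (LinearMap.range b).subtype (fun x => x.2)
  have hq : ∀ t, b ((s ∘ₗ b.rangeRestrict) t) = b t := fun t => hs _
  refine ⟨s ∘ₗ b.rangeRestrict, (LinearMap.id - s ∘ₗ b.rangeRestrict).codRestrict _ fun t => ?_,
    hq, fun k hk => ?_, fun t => ?_⟩
  · have : b.rangeRestrict k = 0 := Subtype.ext hk
    rw [LinearMap.comp_apply, this, map_zero]
  · simp
  · rw [LinearMap.mem_ker, LinearMap.sub_apply, map_sub, hq, LinearMap.id_apply, sub_self]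

/-- Extension of a cokernel isomorphism over one more block. The pair `(f, g)` describes an
isomorphism between the cokernels of the block triangular maps `(_, X; 0, b)` and `(a', X'; 0, b')`:
it sends the class of `v` to the class of `w` if `f v = g w`. -/
lemma exists_block_extension {M N Q : Type*} [AddCommGroup M] [AddCommGroup N]
    [AddCommGroup Q] [Module.Free ℤ N] [Module.Finite ℤ N]
    (a' u : M →ₗ[ℤ] M) (X X' : N →ₗ[ℤ] M) (b b' v w₀ : N →ₗ[ℤ] N)
    (hw₀ : Function.Surjective w₀) (hvw : ∀ t, b' (w₀ t) = v (b t))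
    (θ : LinearMap.ker b ≃ₗ[ℤ] LinearMap.ker b')
    (hconn : ∀ k : LinearMap.ker b, ∃ z, a' z = u (X k) - X' (θ k))
    (f g : M × N →ₗ[ℤ] Q) (hg : Function.Surjective g)
    (hker : ∀ x, g x = 0 → ∃ z : M × N, a' z.1 + X' z.2 = x.1 ∧ b' z.2 = x.2)
    (hker' : ∀ t, g (X' t, b' t) = 0)
    (hf : ∀ t, f (X t, b t) = 0) (hfu : ∀ x, f (x, 0) = g (u x, 0))
    (htop : ∀ y x, f (0, y) = g x → ∃ t, b' t = x.2 - v y) :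
    ∃ (Z Y : N →ₗ[ℤ] M) (w : N →ₗ[ℤ] N), Function.Surjective w ∧
      (∀ t, b' (w t) = v (b t)) ∧ (∀ k : LinearMap.ker b, w k = θ k) ∧
      (∀ t, u (X t) + Z (b t) = a' (Y t) + X' (w t)) ∧ ∀ y, f (0, y) = g (Z y, v y) := by
  obtain ⟨q, p, hbq, hqk, hpq⟩ := exists_ker_projection b
  obtain ⟨F, hF⟩ := exists_linearMap_lift g (f ∘ₗ LinearMap.inr ℤ M N) (fun x => hg _)
  -- The second component of the lift `F` agrees with `v` modulo the image of `b'`; subtracting `(X'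
  -- T, b' T)`, which `g` kills, makes it equal to `v`.
  obtain ⟨T, hT⟩ := exists_linearMap_lift b' (LinearMap.snd ℤ M N ∘ₗ F - v)
    (fun y => htop y (F y) (hF y).symm)
  let Z : N →ₗ[ℤ] M := LinearMap.fst ℤ M N ∘ₗ F - X' ∘ₗ T
  have hZ : ∀ y, f (0, y) = g (Z y, v y) := by
    intro y
    have h1 : F y = (Z y, v y) + (X' (T y), b' (T y)) := by
      ext
      · simp [Z]
      · simp [hT]
    have h2 : g (F y) = f (0, y) := hF y
    rw [← h2, h1, map_add, hker', add_zero]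
  have hG : ∀ t, ∃ z : M × N, (a' ∘ₗ LinearMap.fst ℤ M N + X' ∘ₗ LinearMap.snd ℤ M N).prod
      (b' ∘ₗ LinearMap.snd ℤ M N) z = (u ∘ₗ X + Z ∘ₗ b).prod (v ∘ₗ b) t := by
    intro t
    obtain ⟨z, h1, h2⟩ := hker (u (X t) + Z (b t), v (b t)) (by
      have : ((u (X t) + Z (b t), v (b t)) : M × N) = (u (X t), 0) + (Z (b t), v (b t)) := by simp
      rw [this, map_add, ← hfu, ← hZ, ← map_add, ← hf t]
      simp)
    exact ⟨z, Prod.ext h1 h2⟩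
  obtain ⟨G, hG⟩ := exists_linearMap_lift _ _ hG
  have hG1 : ∀ t, a' (G t).1 + X' (G t).2 = u (X t) + Z (b t) := fun t => congrArg Prod.fst (hG t)
  have hG2 : ∀ t, b' (G t).2 = v (b t) := fun t => congrArg Prod.snd (hG t)
  obtain ⟨z, hz⟩ := exists_linearMap_lift a' (u ∘ₗ X ∘ₗ (LinearMap.ker b).subtype -
    X' ∘ₗ (LinearMap.ker b').subtype ∘ₗ θ.toLinearMap) hconn
  replace hz : ∀ k : LinearMap.ker b, a' (z k) = u (X k) - X' (θ k) := hz
  -- The second component of `G` need not restrict to `θ`, so `G` is used only on the complement of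
  -- `ker b`; on `ker b` the pair `(z, θ)` replaces it.
  let Y : N →ₗ[ℤ] M := z ∘ₗ p + LinearMap.fst ℤ M N ∘ₗ G ∘ₗ q
  let w : N →ₗ[ℤ] N := (LinearMap.ker b').subtype ∘ₗ θ.toLinearMap ∘ₗ p +
    LinearMap.snd ℤ M N ∘ₗ G ∘ₗ q
  have hw : ∀ t, w t = θ (p t) + (G (q t)).2 := fun t => rfl
  have hY : ∀ t, Y t = z (p t) + (G (q t)).1 := fun t => rfl
  have hwθ : ∀ k : LinearMap.ker b, w k = θ k := by
    intro k
    have : p k = k := Subtype.ext (by simpa [hqk k k.2] using hpq k)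
    rw [hw, hqk k k.2, this]
    simp
  have hbw : ∀ t, b' (w t) = v (b t) := by
    intro t
    rw [hw, map_add, hG2, hbq, LinearMap.mem_ker.1 (θ (p t)).2, zero_add]
  refine ⟨Z, Y, w, fun x => ?_, hbw, hwθ, fun t => ?_, hZ⟩
  -- `w` and `w₀` differ by values in `ker b'`, all of which `w` attains on `ker b` through `θ`.
  · obtain ⟨t, rfl⟩ := hw₀ x
    have hk : w₀ t - w t ∈ LinearMap.ker b' := by
      rw [LinearMap.mem_ker, map_sub, hvw, hbw, sub_self]
    refine ⟨t + (θ.symm ⟨_, hk⟩ : LinearMap.ker b), ?_⟩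
    rw [map_add, hwθ, LinearEquiv.apply_symm_apply]
    simp
  · have h1 : u (X t) = u (X (p t)) + u (X (q t)) := by
      rw [← map_add, ← map_add, hpq]
    rw [h1, hY, hw, map_add, map_add, hz, ← hbq t, add_assoc, ← hG1]
    abel

end Lifting

variable {P : Type*} [PartialOrder P] [Fintype P] {n : P → ℕ}

/-! ### Products of block matrices over the poset -/

section Blocks

lemma sum_pos_eq_sum_idx {f : Pos n → ℤ} {c : Set P} (hf : ∀ z, f z ≠ 0 → z.1 ∈ c) :
    ∑ z, f z = ∑ z : Idx n c, f z.1 := by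
  symm
  refine Finset.sum_of_injOn (fun z : Idx n c => z.1) Subtype.val_injective.injOn (by simp) ?_ ?_
  · intro z _ hz
    by_contra h0
    exact hz ⟨⟨z, hf z h0⟩, Finset.mem_coe.2 (Finset.mem_univ _), rfl⟩
  · intro z _
    rfl

lemma sum_pos_eq_add {f : Pos n → ℤ} {i : P} (hf : ∀ z, f z ≠ 0 → z.1 ≤ i) :
    ∑ z, f z = ∑ z : Idx n (Set.Iio i), f z.1 + ∑ z : Idx n {i}, f z.1 := by
  classical
  have h : ∀ z, f z = (if z.1 < i then f z else 0) + (if z.1 = i then f z else 0) := by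
    intro z
    rcases eq_or_ne (f z) 0 with h0 | h0
    · simp [h0]
    · rcases (hf z h0).lt_or_eq with h | h
      · simp [h, h.ne]
      · simp [h]
  rw [Finset.sum_congr rfl fun z _ => h z, Finset.sum_add_distrib,
    sum_pos_eq_sum_idx (c := Set.Iio i), sum_pos_eq_sum_idx (c := {i})]
  · congr 1
    · exact Finset.sum_congr rfl fun z _ => if_pos z.2
    · exact Finset.sum_congr rfl fun z _ => if_pos z.2
  · intro z hz
    by_contra h0
    exact hz (if_neg h0)
  · intro z hz
    by_contra h0
    exact hz (if_neg h0)

lemma IsMP.mul {A C : Matrix (Pos n) (Pos n) ℤ} (hA : IsMP A) (hC : IsMP C) : IsMP (A * C) := by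
  intro x y h
  rw [Matrix.mul_apply] at h
  obtain ⟨z, -, hz⟩ := Finset.exists_ne_zero_of_sum_ne_zero h
  exact (hA _ _ (left_ne_zero_of_mul hz)).trans (hC _ _ (right_ne_zero_of_mul hz))

/-- A nonzero term has its middle index between the outer two, hence in the order-convex set `c`. -/
lemma sub_mul {A C : Matrix (Pos n) (Pos n) ℤ} (hA : IsMP A) (hC : IsMP C) {c : Set P}
    (hc : c.OrdConnected) : sub (A * C) c = sub A c * sub C c := by
  ext x y
  change (A * C) x.1 y.1 = ∑ z : Idx n c, A x.1 z.1 * C z.1 y.1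
  rw [Matrix.mul_apply]
  exact sum_pos_eq_sum_idx fun z hz => hc.out x.2 y.2
    ⟨hA _ _ (left_ne_zero_of_mul hz), hC _ _ (right_ne_zero_of_mul hz)⟩

lemma block_mul (A : Matrix (Pos n) (Pos n) ℤ) {C : Matrix (Pos n) (Pos n) ℤ} (hC : IsMP C)
    (i : P) : block (A * C) (Set.Iio i) {i} =
      sub A (Set.Iio i) * block C (Set.Iio i) {i} + block A (Set.Iio i) {i} * sub C {i} := by
  ext x y
  change (A * C) x.1 y.1 = ∑ z : Idx n (Set.Iio i), A x.1 z.1 * C z.1 y.1 +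
    ∑ z : Idx n {i}, A x.1 z.1 * C z.1 y.1
  rw [Matrix.mul_apply]
  exact sum_pos_eq_add fun z hz => (hC _ _ (right_ne_zero_of_mul hz)).trans_eq y.2

lemma eq_on_column {A C : Matrix (Pos n) (Pos n) ℤ} (hA : IsMP A) (hC : IsMP C) {i : P}
    (h₁ : block A (Set.Iio i) {i} = block C (Set.Iio i) {i}) (h₂ : sub A {i} = sub C {i})
    (x y : Pos n) (hy : y.1 = i) : A x y = C x y := by
  by_cases hx : x.1 ≤ i
  · rcases hx.lt_or_eq with h | h
    · exact congrFun (congrFun h₁ ⟨x, h⟩) ⟨y, hy⟩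
    · exact congrFun (congrFun h₂ ⟨x, h⟩) ⟨y, hy⟩
  · subst hy
    rw [not_imp_comm.1 (hA x y) hx, not_imp_comm.1 (hC x y) hx]

lemma sub_congr {A C : Matrix (Pos n) (Pos n) ℤ} {c : Set P}
    (h : ∀ x y, y.1 ∈ c → A x y = C x y) : sub A c = sub C c := by
  ext x y
  exact h _ _ y.2

/-- Lets later columns of `U` change without disturbing columns of `U B` already settled. -/
lemma mul_apply_congr_left {A A' C : Matrix (Pos n) (Pos n) ℤ} (hC : IsMP C) {y : Pos n}
    (h : ∀ x z : Pos n, z.1 ≤ y.1 → A x z = A' x z) (x : Pos n) :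
    (A * C) x y = (A' * C) x y := by
  rw [Matrix.mul_apply, Matrix.mul_apply]
  refine Finset.sum_congr rfl fun z _ => ?_
  by_cases hz : z.1 ≤ y.1
  · rw [h x z hz]
  · rw [not_imp_comm.1 (hC z y) hz, mul_zero, mul_zero]

lemma mul_apply_congr_right {A C C' : Matrix (Pos n) (Pos n) ℤ} {y : Pos n}
    (h : ∀ x : Pos n, C x y = C' x y) (x : Pos n) :
    (A * C) x y = (A * C') x y := by
  rw [Matrix.mul_apply, Matrix.mul_apply]
  exact Finset.sum_congr rfl fun z _ => by rw [h]

end Blocks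

/-! ### Splitting off the top block of a principal down-set -/

section Split

lemma singleton_subset_Iic (i : P) : {i} ⊆ Set.Iic i :=
  Set.singleton_subset_iff.2 (le_refl i)

variable (n) in
/-- Vectors over `{j : j ≤ i}` as pairs of a vector over `{j : j < i}` and one over `{i}`. -/
def join (i : P) : (Idx n (Set.Iio i) → ℤ) × (Idx n {i} → ℤ) →ₗ[ℤ] (Idx n (Set.Iic i) → ℤ) :=
  (extVec n Set.Iio_subset_Iic_self).coprod (extVec n (singleton_subset_Iic i))

lemma join_incl_Iio (i : P) (v : (Idx n (Set.Iio i) → ℤ) × (Idx n {i} → ℤ))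
    (k : Idx n (Set.Iio i)) : join n i v (Idx.incl n Set.Iio_subset_Iic_self k) = v.1 k := by
  rw [join, LinearMap.coprod_apply, Pi.add_apply, extVec_incl,
    extVec_of_notMem n (singleton_subset_Iic i) v.2 (Idx.incl n _ k)
      (ne_of_lt (show k.1.1 < i from k.2)), add_zero]

lemma join_incl_singleton (i : P) (v : (Idx n (Set.Iio i) → ℤ) × (Idx n {i} → ℤ))
    (k : Idx n {i}) : join n i v (Idx.incl n (singleton_subset_Iic i) k) = v.2 k := by
  rw [join, LinearMap.coprod_apply, Pi.add_apply, extVec_incl,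
    extVec_of_notMem n Set.Iio_subset_Iic_self v.1 (Idx.incl n _ k)
      (fun h : k.1.1 < i => h.ne k.2), zero_add]

/-- Every position over `{j : j ≤ i}` lies over `{j : j < i}` or over `{i}`. -/
lemma Idx.Iic_cases {i : P} {p : Idx n (Set.Iic i) → Prop}
    (h₁ : ∀ k, p (Idx.incl n Set.Iio_subset_Iic_self k))
    (h₂ : ∀ k, p (Idx.incl n (singleton_subset_Iic i) k)) (k : Idx n (Set.Iic i)) : p k := by
  rcases (show k.1.1 ≤ i from k.2).lt_or_eq with h | h
  · exact h₁ ⟨k.1, h⟩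
  · exact h₂ ⟨k.1, h⟩

lemma join_bijective (i : P) : Function.Bijective (join n i) := by
  constructor
  · intro v w h
    refine Prod.ext (funext fun k => ?_) (funext fun k => ?_)
    · rw [← join_incl_Iio, h, join_incl_Iio]
    · rw [← join_incl_singleton, h, join_incl_singleton]
  · intro x
    exact ⟨(fun k => x (Idx.incl n _ k), fun k => x (Idx.incl n _ k)),
      funext (Idx.Iic_cases (join_incl_Iio i _) (join_incl_singleton i _))⟩

lemma resVec_join (i : P) (v : (Idx n (Set.Iio i) → ℤ) × (Idx n {i} → ℤ)) :
    resVec n (singleton_subset_Iic i) (join n i v) = v.2 :=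
  funext fun k => join_incl_singleton i v k

lemma sum_Iic_eq_add {i : P} (f : Idx n (Set.Iic i) → ℤ) :
    ∑ z, f z = ∑ z, f (Idx.incl n Set.Iio_subset_Iic_self z) +
      ∑ z, f (Idx.incl n (singleton_subset_Iic i) z) := by
  classical
  let g : Pos n → ℤ := fun z => if h : z.1 ≤ i then f ⟨z, h⟩ else 0
  have hg : ∀ z, g z ≠ 0 → z.1 ≤ i := fun z hz => by
    by_contra h0
    exact hz (dif_neg h0)
  have hgf : ∀ z : Idx n (Set.Iic i), f z = g z.1 := fun z => by
    simp only [g]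
    rw [dif_pos (show z.1.1 ≤ i from z.2)]
    rfl
  rw [Finset.sum_congr rfl fun z _ => hgf z,
    ← sum_pos_eq_sum_idx (c := Set.Iic i) hg, sum_pos_eq_add hg]
  exact congrArg₂ _ (Finset.sum_congr rfl fun z _ => (hgf (Idx.incl n _ z)).symm)
    (Finset.sum_congr rfl fun z _ => (hgf (Idx.incl n _ z)).symm)

lemma sub_mulVec_join {A : Matrix (Pos n) (Pos n) ℤ} (hA : IsMP A) (i : P)
    (v : (Idx n (Set.Iio i) → ℤ) × (Idx n {i} → ℤ)) :
    (sub A (Set.Iic i)).mulVec (join n i v) =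
      join n i ((sub A (Set.Iio i)).mulVec v.1 + (block A (Set.Iio i) {i}).mulVec v.2,
        (sub A {i}).mulVec v.2) := by
  have key : ∀ k, (sub A (Set.Iic i)).mulVec (join n i v) k =
      ∑ l : Idx n (Set.Iio i), A k.1 l.1 * v.1 l + ∑ l : Idx n {i}, A k.1 l.1 * v.2 l := by
    intro k
    refine (sum_Iic_eq_add _).trans (congrArg₂ _ (Finset.sum_congr rfl fun z _ => ?_)
      (Finset.sum_congr rfl fun z _ => ?_))
    · rw [join_incl_Iio]
      rfl
    · rw [join_incl_singleton]
      rfl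
  refine funext (Idx.Iic_cases (fun k => ?_) fun k => ?_)
  · rw [key, join_incl_Iio]
    rfl
  · rw [key, join_incl_singleton, Finset.sum_eq_zero, zero_add]
    · rfl
    · intro l _
      rw [not_imp_comm.1 (hA _ l.1), zero_mul]
      have hk : k.1.1 = i := k.2
      rw [Idx.incl, hk]
      exact not_le_of_gt l.2

end Split

/-! ### Replacing a block column -/

section Column

variable [DecidableEq P]

open Classical in
/-- Replace the block column of `U` at `i` by `Z` above the diagonal and `A` on the diagonal. -/
def setColumn (U : Matrix (Pos n) (Pos n) ℤ) (i : P)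
    (Z : Matrix (Idx n (Set.Iio i)) (Idx n {i}) ℤ) (A : Matrix (Idx n {i}) (Idx n {i}) ℤ) :
    Matrix (Pos n) (Pos n) ℤ := fun x y =>
  if hy : y.1 = i then
    if hx : x.1 < i then Z ⟨x, hx⟩ ⟨y, hy⟩
    else if hx : x.1 = i then A ⟨x, hx⟩ ⟨y, hy⟩ else 0
  else U x y

variable (U : Matrix (Pos n) (Pos n) ℤ) (i : P) (Z : Matrix (Idx n (Set.Iio i)) (Idx n {i}) ℤ)
  (A : Matrix (Idx n {i}) (Idx n {i}) ℤ)

lemma setColumn_of_ne (x y : Pos n) (hy : y.1 ≠ i) : setColumn U i Z A x y = U x y :=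
  dif_neg hy

lemma sub_setColumn_of_notMem {c : Set P} (hc : i ∉ c) : sub (setColumn U i Z A) c = sub U c :=
  sub_congr fun x y hy => setColumn_of_ne U i Z A x y fun h => hc (h ▸ hy)

lemma block_setColumn : block (setColumn U i Z A) (Set.Iio i) {i} = Z := by
  ext x y
  exact (dif_pos y.2).trans (dif_pos x.2)

lemma sub_setColumn : sub (setColumn U i Z A) {i} = A := by
  ext x y
  have hx : x.1.1 = i := x.2
  exact (dif_pos y.2).trans ((dif_neg (by rw [hx]; exact lt_irrefl i)).trans (dif_pos x.2))

variable {U} in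
lemma IsMP.setColumn (hU : IsMP U) : IsMP (setColumn U i Z A) := by
  intro x y h
  by_cases hy : y.1 = i
  · by_contra hxy
    rw [hy] at hxy
    exact h ((dif_pos hy).trans ((dif_neg fun h => hxy h.le).trans (dif_neg fun h => hxy h.le)))
  · rw [setColumn_of_ne U i Z A x y hy] at h
    exact hU x y h

end Column

/-! ### Determinants and inverses in `GL_P` -/

section Inverse

variable [DecidableEq P]

lemma IsMP.blockTriangular {A : Matrix (Pos n) (Pos n) ℤ} (hA : IsMP A) {α : Type*} [Preorder α]
    {b : P → α} (hb : Monotone b) : A.BlockTriangular fun x => b x.1 := by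
  intro x y h
  by_contra h0
  exact not_le_of_gt h (hb (hA x y h0))

/-- A linear extension makes `A` block triangular, and its fibres are single poset elements. -/
lemma isUnit_det {A : Matrix (Pos n) (Pos n) ℤ} (hA : IsGLP A) : IsUnit A.det := by
  rw [(hA.1.blockTriangular (toLinearExtension (α := P)).monotone).det]
  refine (IsUnit.prod_iff).2 fun a ha => ?_
  obtain ⟨x, -, rfl⟩ := Finset.mem_image.1 ha
  have h := hA.2 x.1
  let e : {y : Pos n // toLinearExtension y.1 = toLinearExtension x.1} ≃ Idx n {x.1} :=
    Equiv.subtypeEquivRight fun y => Iff.rfl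
  rw [← Matrix.det_submatrix_equiv_self e] at h
  exact h

lemma IsMP.inv {A : Matrix (Pos n) (Pos n) ℤ} (hA : IsMP A) (hu : IsUnit A.det) : IsMP A⁻¹ := by
  classical
  intro x y h
  by_contra hxy
  have := A.invertibleOfIsUnitDet hu
  -- For a fixed column, the up-set of blocks not below it gives a two-step triangular shape (`False
  -- < True`), which the inverse inherits.
  let b : P → Prop := fun j => ¬ j ≤ y.1
  have hb : Monotone b := fun j k hjk hj hk => hj (hjk.trans hk)
  refine h (Matrix.blockTriangular_inv_of_blockTriangular (hA.blockTriangular hb) ?_)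
  refine lt_of_le_not_ge (fun h => absurd le_rfl h) fun h => h hxy le_rfl

lemma IsGLP.inv {A : Matrix (Pos n) (Pos n) ℤ} (hA : IsGLP A) : IsGLP A⁻¹ := by
  have hu := isUnit_det hA
  refine ⟨hA.1.inv hu, fun i => ?_⟩
  have h := sub_mul hA.1 (hA.1.inv hu) (Set.ordConnected_singleton (a := i))
  rw [Matrix.mul_nonsing_inv _ hu] at h
  have h1 : sub (1 : Matrix (Pos n) (Pos n) ℤ) {i} = 1 :=
    Matrix.submatrix_one _ Subtype.val_injective
  rw [h1] at h
  exact Matrix.isUnit_det_of_left_inverse h.symm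

end Inverse

variable {B B' : Matrix (Pos n) (Pos n) ℤ} {hB : IsMP B} {hB' : IsMP B'}

/-! ### Consequences of the web squares -/

section Web

lemma Cok.mk_eq_iff {ι : Type*} {ν : Type*} [Fintype ν] (M : Matrix ι ν ℤ) (x y : ι → ℤ) :
    Cok.mk M x = Cok.mk M y ↔ ∃ t, M.mulVec t = x - y :=
  Submodule.Quotient.eq _

/-- `U{c}` induces the isomorphism between the cokernels at `c`. -/
def KWebIso.InducedAt (κ : KWebIso hB hB') (U : Matrix (Pos n) (Pos n) ℤ) (c : Set P)
    (hc : IsWebSet c) : Prop :=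
  ∀ x : Idx n c → ℤ, κ.cok c hc (Cok.mk (sub B c) x) = Cok.mk (sub B' c) ((sub U c).mulVec x)

lemma KWebIso.InducedAt.congr {κ : KWebIso hB hB'} {U U' : Matrix (Pos n) (Pos n) ℤ} {c : Set P}
    {hc : IsWebSet c} (h : κ.InducedAt U c hc) (hU : sub U' c = sub U c) :
    κ.InducedAt U' c hc := fun x => by
  rw [hU]
  exact h x

/-- On the boundary of `i` the web isomorphism is determined by the predecessors of `i`. -/
lemma KWebIso.inducedAt_bdry (κ : KWebIso hB hB') {U : Matrix (Pos n) (Pos n) ℤ} (hU : IsMP U)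
    {i : P} (hi : ¬ IsMin i) (h : ∀ j < i, κ.InducedAt U (Set.Iic j) (.closed j)) :
    κ.InducedAt U (Set.Iio i) (.bdry i hi) := by
  classical
  let c := Set.Iio i
  suffices h : (κ.cok c (.bdry i hi)).toLinearMap ∘ₗ Submodule.mkQ _ =
      Submodule.mkQ _ ∘ₗ (sub U c).mulVecLin from fun x => LinearMap.congr_fun h x
  refine LinearMap.pi_ext' fun k => LinearMap.ext_ring ?_
  -- Each unit vector over `Iio i` is extended from `Iic j` for some `j` covered by `i`, where
  -- `comm_link` applies.
  obtain ⟨j, hkj, hji⟩ := exists_le_covBy_of_lt (show k.1.1 < i from k.2)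
  have hsub : Set.Iic j ⊆ Set.Iio i := fun _ hk => lt_of_le_of_lt hk hji.lt
  let s : Idx n (Set.Iic j) → ℤ := fun z => if z.1 = k.1 then 1 else 0
  have hs : (Pi.single k 1 : Idx n c → ℤ) = extVec n hsub s := by
    funext l
    by_cases hl : l.1.1 ≤ j
    · refine Eq.trans ?_ (extVec_incl n hsub s ⟨l.1, hl⟩).symm
      exact (Pi.single_apply k (1 : ℤ) l).trans (if_congr Subtype.ext_iff rfl rfl)
    · rw [extVec_of_notMem n hsub s l hl]
      refine Pi.single_eq_of_ne (fun h => hl ?_) _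
      rw [h]
      exact hkj
  have h1 := κ.comm_link i j hji hi (Cok.mk _ s)
  rw [h j hji.lt s] at h1
  change κ.cok c _ (Cok.mk _ (Pi.single k 1)) = Cok.mk _ ((sub U c).mulVec (Pi.single k 1))
  rw [hs, sub_mulVec_extVec hU hsub (isLowerSet_Iic j)]
  exact h1

/-- For minimal `i` the sets `Iic i` and `{i}` coincide, so they carry the same isomorphism. A
variable `c` permits substitution along this equality of sets. -/
lemma KWebIso.comm_top_of_isMin (κ : KWebIso hB hB') {i : P} {c : Set P} (h : {i} = c)
    (hc : IsWebSet c) (hs : {i} ⊆ c) (hd : ∀ a ∈ ({i} : Set P), ∀ b ∈ c, a ≤ b → b ∈ ({i} : Set P))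
    (x : Cok (sub B c)) : κ.cok {i} (.point i) (cokRes hB hs hd x) =
      cokRes hB' hs hd (κ.cok c hc x) := by
  subst h
  have hid : ∀ (A : Matrix (Pos n) (Pos n) ℤ) (hA : IsMP A) (y : Cok (sub A {i})),
      cokRes hA hs hd y = y := by
    intro A hA y
    obtain ⟨y, rfl⟩ := Submodule.Quotient.mk_surjective _ y
    rfl
  rw [hid, hid]

lemma KWebIso.comm_top' (κ : KWebIso hB hB') (i : P) (x : Cok (sub B (Set.Iic i))) :
    κ.cok {i} (.point i) (cokTop hB i x) = cokTop hB' i (κ.cok (Set.Iic i) (.closed i) x) := by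
  by_cases hi : IsMin i
  · exact κ.comm_top_of_isMin hi.Iic_eq.symm _ _ _ x
  · exact κ.comm_top i hi x

end Web

/-! ### Solving one block column -/

section Step

variable [DecidableEq P]

/-- `U` and `W` have the required properties in the block column `i`. -/
structure ColumnGood (κ : KWebIso hB hB') (U W : Matrix (Pos n) (Pos n) ℤ) (i : P)
    (θ : Ker (sub B {i}) ≃ₗ[ℤ] Ker (sub B' {i})) : Prop where
  eq : ∀ x y : Pos n, y.1 = i → (U * B) x y = (B' * W) x y
  isUnit_left : IsUnit (sub U {i}).det
  isUnit_right : IsUnit (sub W {i}).det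
  point : κ.InducedAt U {i} (.point i)
  closed : κ.InducedAt U (Set.Iic i) (.closed i)
  ker : ∀ k : Ker (sub B {i}), (θ k : Idx n {i} → ℤ) = (sub W {i}).mulVec k

lemma ColumnGood.congr {κ : KWebIso hB hB'} {U W U' W' : Matrix (Pos n) (Pos n) ℤ} {i : P}
    {θ : Ker (sub B {i}) ≃ₗ[ℤ] Ker (sub B' {i})} (h : ColumnGood κ U W i θ)
    (hU : ∀ x y : Pos n, y.1 ≤ i → U' x y = U x y)
    (hW : ∀ x y : Pos n, y.1 ≤ i → W' x y = W x y) : ColumnGood κ U' W' i θ := by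
  have hU1 : sub U' {i} = sub U {i} := sub_congr fun x y hy => hU x y (le_of_eq hy)
  have hW1 : sub W' {i} = sub W {i} := sub_congr fun x y hy => hW x y (le_of_eq hy)
  refine ⟨fun x y hy => ?_, hU1 ▸ h.isUnit_left, hW1 ▸ h.isUnit_right, h.point.congr hU1,
    h.closed.congr (sub_congr hU), fun k => (h.ker k).trans (by rw [hW1])⟩
  rw [mul_apply_congr_left hB (fun x z hz => hU x z (hz.trans_eq hy)), h.eq x y hy]
  exact mul_apply_congr_right (fun x => (hW x y hy.le).symm) x

/-- Each web square feeds one hypothesis of `exists_block_extension`: `comm_conn` gives `hconn`,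
`comm_step` gives `hfu`, and `comm_top` gives `htop`. For minimal `i` the first two are trivial
since `Iio i` is empty. -/
lemma exists_column (κ : KWebIso hB hB') {U W : Matrix (Pos n) (Pos n) ℤ} (hU : IsMP U)
    (hW : IsMP W) (i : P) (hUi : ∀ j < i, κ.InducedAt U (Set.Iic j) (.closed j))
    (hallow : GLAllowable (κ.diag i)) (θ : Ker (sub B {i}) ≃ₗ[ℤ] Ker (sub B' {i}))
    (hθ : ∀ hi : ¬ IsMin i, θ = κ.ker i hi) :
    ∃ Z A Y C, ColumnGood κ (setColumn U i Z A) (setColumn W i Y C) i θ := by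
  obtain ⟨A, V, hA, hV, hAV, hdA⟩ := hallow
  have hVB : sub B' {i} * V⁻¹ = A * sub B {i} := by
    rw [← hAV, Matrix.mul_assoc, Matrix.mul_nonsing_inv V hV, Matrix.mul_one]
  have hg : Function.Surjective (Submodule.mkQ (LinearMap.range (sub B' (Set.Iic i)).mulVecLin) ∘ₗ
      join n i) := (Submodule.mkQ_surjective _).comp (join_bijective i).2
  have hBs : ∀ {D : Matrix (Pos n) (Pos n) ℤ} (hD : IsMP D) (t : Idx n {i} → ℤ),
      Cok.mk (sub D (Set.Iic i))
        (join n i ((block D (Set.Iio i) {i}).mulVec t, (sub D {i}).mulVec t)) = 0 := by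
    intro D hD t
    refine (Submodule.Quotient.mk_eq_zero _).2 ⟨join n i (0, t), ?_⟩
    rw [Matrix.mulVecLin_apply, sub_mulVec_join hD]
    simp
  let f := (κ.cok (Set.Iic i) (.closed i)).toLinearMap ∘ₗ Submodule.mkQ _ ∘ₗ join n i
  let g := Submodule.mkQ (LinearMap.range (sub B' (Set.Iic i)).mulVecLin) ∘ₗ join n i
  have hconn : ∀ k : Ker (sub B {i}), ∃ z, (sub B' (Set.Iio i)).mulVecLin z =
      (sub U (Set.Iio i)).mulVecLin ((block B (Set.Iio i) {i}).mulVecLin k) -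
        (block B' (Set.Iio i) {i}).mulVecLin (θ k) := by
    intro k
    by_cases hi : IsMin i
    · exact ⟨0, funext fun l => absurd l.2 hi.not_lt⟩
    · rw [hθ hi]
      refine (Cok.mk_eq_iff _ _ _).1 ?_
      exact (κ.inducedAt_bdry hU hi hUi _).symm.trans (κ.comm_conn i hi k)
  have hker : ∀ x, g x = 0 → ∃ z : (Idx n (Set.Iio i) → ℤ) × (Idx n {i} → ℤ),
      (sub B' (Set.Iio i)).mulVecLin z.1 + (block B' (Set.Iio i) {i}).mulVecLin z.2 = x.1 ∧
        (sub B' {i}).mulVecLin z.2 = x.2 := by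
    intro x hx
    obtain ⟨t, ht⟩ := (Submodule.Quotient.mk_eq_zero _).1 hx
    obtain ⟨z, rfl⟩ := (join_bijective i).2 t
    rw [Matrix.mulVecLin_apply, sub_mulVec_join hB'] at ht
    have := (join_bijective i).1 ht
    exact ⟨z, congrArg Prod.fst this, congrArg Prod.snd this⟩
  have hfu : ∀ x, f (x, 0) = g ((sub U (Set.Iio i)).mulVecLin x, 0) := by
    intro x
    by_cases hi : IsMin i
    · have : ∀ y : Idx n (Set.Iio i) → ℤ, y = 0 := fun y => funext fun l => absurd l.2 hi.not_lt
      rw [this x, map_zero]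
      exact (map_zero f).trans (map_zero g).symm
    · have h1 := κ.comm_step i hi (Cok.mk _ x)
      rw [κ.inducedAt_bdry hU hi hUi] at h1
      simp only [f, g, join, LinearMap.comp_apply, LinearMap.coprod_apply, map_zero, add_zero]
      exact h1
  have htop : ∀ y x, f (0, y) = g x → ∃ t, (sub B' {i}).mulVecLin t = x.2 - A.mulVecLin y := by
    intro y x hyx
    have h1 := κ.comm_top' i (Cok.mk _ (join n i (0, y)))
    have h2 : cokTop hB i (Cok.mk _ (join n i (0, y))) = Cok.mk _ y :=
      congrArg (Cok.mk _) (resVec_join i (0, y))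
    have h3 : cokTop hB' i (Cok.mk _ (join n i x)) = Cok.mk _ x.2 :=
      congrArg (Cok.mk _) (resVec_join i x)
    have h4 : κ.cok (Set.Iic i) (.closed i) (Cok.mk _ (join n i (0, y))) =
      Cok.mk _ (join n i x) := hyx
    rw [h2, h4, h3] at h1
    exact (Cok.mk_eq_iff _ _ _).1 (h1.symm.trans (hdA y))
  -- `V⁻¹` enters only as the surjection `w₀`; the new diagonal block `w` may differ from it.
  obtain ⟨Z, Y, w, hw, hbw, hwθ, hcol, hZ⟩ := exists_block_extension
    (sub B' (Set.Iio i)).mulVecLin (sub U (Set.Iio i)).mulVecLin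
    (block B (Set.Iio i) {i}).mulVecLin (block B' (Set.Iio i) {i}).mulVecLin
    (sub B {i}).mulVecLin (sub B' {i}).mulVecLin A.mulVecLin (V⁻¹).mulVecLin
    (Matrix.mulVec_surjective_iff_isUnit.2
      ((Matrix.isUnit_iff_isUnit_det _).2 (Matrix.isUnit_nonsing_inv_det V hV)))
    (fun t => by simp only [Matrix.mulVecLin_apply, Matrix.mulVec_mulVec, hVB])
    θ hconn f g hg hker (fun t => hBs hB' t)
    (fun t => (congrArg (κ.cok (Set.Iic i) (.closed i)) (hBs hB t)).trans (map_zero _)) hfu htop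
  refine ⟨LinearMap.toMatrix' Z, A, LinearMap.toMatrix' Y, LinearMap.toMatrix' w, ?_⟩
  have hmem : i ∉ Set.Iio i := lt_irrefl i
  have hU' := hU.setColumn i (LinearMap.toMatrix' Z) A
  have hW' := hW.setColumn i (LinearMap.toMatrix' Y) (LinearMap.toMatrix' w)
  refine ⟨eq_on_column (hU'.mul hB) (hB'.mul hW') ?_ ?_, ?_, ?_, fun x => ?_, fun x => ?_,
    fun k => ?_⟩
  · rw [block_mul _ hB, block_mul _ hW', sub_setColumn, block_setColumn, block_setColumn,
      sub_setColumn_of_notMem U i _ _ hmem]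
    refine Matrix.toLin'.injective (LinearMap.ext fun t => ?_)
    simpa [Matrix.add_mulVec, ← Matrix.mulVec_mulVec, LinearMap.toMatrix'_mulVec] using hcol t
  · rw [sub_mul hU' hB Set.ordConnected_singleton, sub_mul hB' hW' Set.ordConnected_singleton,
      sub_setColumn, sub_setColumn]
    refine Matrix.toLin'.injective (LinearMap.ext fun t => ?_)
    simpa [← Matrix.mulVec_mulVec, LinearMap.toMatrix'_mulVec] using (hbw t).symm
  · rwa [sub_setColumn]
  -- A surjective square integer matrix is invertible.
  · rw [sub_setColumn, ← Matrix.isUnit_iff_isUnit_det, ← Matrix.mulVec_surjective_iff_isUnit]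
    intro x
    obtain ⟨t, rfl⟩ := hw x
    exact ⟨t, LinearMap.toMatrix'_mulVec w t⟩
  · rw [sub_setColumn]
    exact hdA x
  · obtain ⟨⟨x, y⟩, rfl⟩ := (join_bijective i).2 x
    rw [sub_mulVec_join hU', block_setColumn, sub_setColumn, sub_setColumn_of_notMem U i _ _ hmem,
      LinearMap.toMatrix'_mulVec]
    have h1 : f (x, y) = f (x, 0) + f (0, y) := by
      rw [← map_add, Prod.mk_add_mk, add_zero, zero_add]
    refine h1.trans ?_
    rw [hfu, hZ, ← map_add, Prod.mk_add_mk, zero_add]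
    rfl
  · rw [sub_setColumn, LinearMap.toMatrix'_mulVec]
    exact (hwθ k).symm

end Step

/-! ### Assembling the columns -/

section Assembly

variable [DecidableEq P]

/-- Induction removes a maximal `i` from `S`. Conditions at `j` involve only columns below or equal
to `j`, so overwriting column `i` keeps them. -/
lemma exists_columns (κ : KWebIso hB hB') (hallow : ∀ i, GLAllowable (κ.diag i))
    (θ : ∀ i, Ker (sub B {i}) ≃ₗ[ℤ] Ker (sub B' {i}))
    (hθ : ∀ (i : P) (hi : ¬ IsMin i), θ i = κ.ker i hi) (S : Finset P)
    (hS : IsLowerSet (S : Set P)) :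
    ∃ U W : Matrix (Pos n) (Pos n) ℤ, IsMP U ∧ IsMP W ∧ ∀ i ∈ S, ColumnGood κ U W i (θ i) := by
  induction S using Finset.strongInduction with
  | H S ih =>
    rcases S.eq_empty_or_nonempty with rfl | hne
    · exact ⟨0, 0, fun x y h => absurd rfl h, fun x y h => absurd rfl h, by simp⟩
    · obtain ⟨i, hi⟩ := S.exists_maximal hne
      have hlow : IsLowerSet ((S.erase i : Finset P) : Set P) := by
        intro a b hba ha
        rw [Finset.mem_coe, Finset.mem_erase] at ha ⊢
        refine ⟨?_, hS hba ha.2⟩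
        rintro rfl
        exact ha.1 (le_antisymm (hi.2 ha.2 hba) hba)
      obtain ⟨U, W, hU, hW, h⟩ := ih _ (Finset.erase_ssubset hi.1) hlow
      obtain ⟨Z, A, Y, C, hcol⟩ := exists_column κ hU hW i
        (fun j hj => (h j (Finset.mem_erase.2 ⟨hj.ne, hS hj.le hi.1⟩)).closed)
        (hallow i) (θ i) (hθ i)
      refine ⟨_, _, hU.setColumn i Z A, hW.setColumn i Y C, fun j hj => ?_⟩
      by_cases hji : j = i
      · rw [hji]
        exact hcol
      · have hne : ∀ y : Pos n, y.1 ≤ j → y.1 ≠ i := by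
          rintro y hy rfl
          exact hji (le_antisymm (hi.2 hj hy) hy)
        exact (h j (Finset.mem_erase.2 ⟨hji, hj⟩)).congr
          (fun x y hy => setColumn_of_ne U i Z A x y (hne y hy))
          (fun x y hy => setColumn_of_ne W i Y C x y (hne y hy))

lemma exists_equiv_of_allowable (κ : KWebIso hB hB') (hallow : ∀ i, GLAllowable (κ.diag i))
    (ψ : ∀ i : P, IsMin i → (Ker (sub B {i}) ≃ₗ[ℤ] Ker (sub B' {i}))) :
    ∃ U V : Matrix (Pos n) (Pos n) ℤ, IsGLPEquiv U V B B' ∧ κ.InducedBy U V ∧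
      ∀ (i : P) (hi : IsMin i), InducesKer V i (ψ i hi) := by
  classical
  -- Kernels at minimal elements are not part of the web, so `ψ` can be prescribed there.
  let θ : ∀ i, Ker (sub B {i}) ≃ₗ[ℤ] Ker (sub B' {i}) := fun i =>
    if hi : IsMin i then ψ i hi else κ.ker i hi
  obtain ⟨U, W, hU, hW, h⟩ := exists_columns κ hallow θ (fun i hi => dif_neg hi) Finset.univ
    (by simpa using isLowerSet_univ)
  replace h := fun i => h i (Finset.mem_univ i)
  have hWG : IsGLP W := ⟨hW, fun i => (h i).isUnit_right⟩
  have hWu := isUnit_det hWG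
  have hVinv : W⁻¹⁻¹ = W := Matrix.nonsing_inv_nonsing_inv W hWu
  have heq : U * B = B' * W := by
    ext x y
    exact (h y.1).eq x y rfl
  refine ⟨U, W⁻¹, ⟨⟨hU, fun i => (h i).isUnit_left⟩, hWG.inv, ?_⟩,
    ⟨fun c hc => ?_, fun i hi x => ?_⟩, fun i hi x => ?_⟩
  · rw [heq, Matrix.mul_assoc, Matrix.mul_nonsing_inv W hWu, Matrix.mul_one]
  · cases hc with
    | point i => exact (h i).point
    | closed i => exact (h i).closed
    | bdry i hi => exact κ.inducedAt_bdry hU hi fun j _ => (h j).closed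
  · rw [hVinv, ← (h i).ker, show θ i = κ.ker i hi from dif_neg hi]
  · rw [hVinv, ← (h i).ker, show θ i = ψ i hi from dif_pos hi]

lemma allowable_of_inducedBy (κ : KWebIso hB hB') {U V : Matrix (Pos n) (Pos n) ℤ}
    (hUV : IsGLPEquiv U V B B') (hκ : κ.InducedBy U V) (i : P) : GLAllowable (κ.diag i) := by
  obtain ⟨hU, hV, hEq⟩ := hUV
  refine ⟨sub U {i}, sub V {i}, hU.2 i, hV.2 i, ?_, hκ.1 {i} (.point i)⟩
  rw [← hEq, sub_mul (hU.1.mul hB) hV.1 Set.ordConnected_singleton,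
    sub_mul hU.1 hB Set.ordConnected_singleton]

end Assembly

end KWeb

end

theorem mainTheorem11 {P : Type*} [PartialOrder P] [Fintype P] [DecidableEq P]
    (n : P → ℕ) (hn : ∀ i, n i ≠ 0)
    (B B' : Matrix (KWeb.Pos n) (KWeb.Pos n) ℤ) (hB : KWeb.IsMP B) (hB' : KWeb.IsMP B')
    (hdiag : ∀ i : P, KWeb.sub B {i} = KWeb.sub B' {i})
    (κ : KWeb.KWebIso hB hB')
    (ψ : ∀ i : P, IsMin i → (KWeb.Ker (KWeb.sub B {i}) ≃ₗ[ℤ] KWeb.Ker (KWeb.sub B' {i}))) :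
    ((∃ U V : Matrix (KWeb.Pos n) (KWeb.Pos n) ℤ,
        KWeb.IsGLPEquiv U V B B' ∧ κ.InducedBy U V) ↔
      ∀ i : P, KWeb.GLAllowable (κ.diag i)) ∧
    ((∃ U V : Matrix (KWeb.Pos n) (KWeb.Pos n) ℤ,
        KWeb.IsGLPEquiv U V B B' ∧ κ.InducedBy U V) →
      ∃ U V : Matrix (KWeb.Pos n) (KWeb.Pos n) ℤ,
        KWeb.IsGLPEquiv U V B B' ∧ κ.InducedBy U V ∧
          ∀ (i : P) (hi : IsMin i), KWeb.InducesKer V i (ψ i hi)) := by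
  refine ⟨⟨?_, fun h => ?_⟩, ?_⟩
  · rintro ⟨U, V, hUV, hκ⟩ i
    exact KWeb.allowable_of_inducedBy κ hUV hκ i
  · obtain ⟨U, V, hUV, hκ, -⟩ := KWeb.exists_equiv_of_allowable κ h ψ
    exact ⟨U, V, hUV, hκ⟩
  -- The given equivalence serves only to prove allowability; a new one is then built with `ψ`
  -- prescribed.
  · rintro ⟨U, V, hUV, hκ⟩
    exact KWeb.exists_equiv_of_allowable κ (KWeb.allowable_of_inducedBy κ hUV hκ) ψ
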